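/- Let $K$ be a field, $\theta : K \to K$ a ring homomorphism and $\delta : K \to K$ a $\theta$-derivation, that is, an additive map with $\delta(ab) = \theta(a)\delta(b) + \delta(a)b$ for all $a, b \in K$. Let $F = \{a \in K : \theta(a) = a,\ \delta(a) = 0\}$, a subfield of $K$, and assume that $K/F$ is finite. Let $\mathcal{A}^+ = K[X;\theta,\delta]$ be the ring of Ore polynomials $\sum_i a_i X^i$ ($a_i \in K$), with multiplication determined by $Xa = \theta(a)X + \delta(a)$ for $a \in K$, and let $\mathcal{Z}^+$ be its centre. Let $c \in K$ be unramified, i.e. the map $\delta + c\,\theta : K \to K$ is not a scalar multiple of $\mathrm{id}_K$. Let $\mathrm{ev}_c : \mathcal{A}^+ \to \mathrm{End}_F(K)$ be the ring homomorphism $\sum_i a_i X^i \mapsto \sum_i a_i (\delta + c\,\theta)^i$. Then there is a monic $Z(X) \in \mathcal{Z}^+$ with $\mathcal{Z}^+ = F[Z(X)]$. For every such $Z(X)$, put $\mathcal{C}^+ = K[Z(X)]$, a commutative subring of $\mathcal{A}^+$, and let $\upsilon(c) \in K$ be the remainder of the right Euclidean division of $Z(X)$ by $X - c$, so that $Z(X)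 = Q\cdot(X - c) + \upsilon(c)$ for some $Q \in \mathcal{A}^+$. Then $\mathcal{A}^+$ is a free left $\mathcal{C}^+$-module of finite rank. For $f \in \mathcal{A}^+$, let $T_{\mathrm{rd}}(f) \in \mathcal{C}^+$ be the trace of the $\mathcal{C}^+$-linear endomorphism $x \mapsto xf$ of $\mathcal{A}^+$. The following hold: $T_{\mathrm{rd}}(f) \in \mathcal{Z}^+$ for all $f \in \mathcal{A}^+$; $\upsilon(c) \in F$; there is an $F$-algebra homomorphism $\mathrm{sp}_c : \mathcal{Z}^+ \to F$ with $\mathrm{sp}_c(Z(X)) = \upsilon(c)$; and $$\mathrm{sp}_c\big(T_{\mathrm{rd}}(f)\big) = \mathrm{Tr}\big(\mathrm{ev}_c(f)\big) \quad \text{for all } f \in \mathcal{A}^+,$$ where $\mathrm{Tr}$ is the usual trace of $F$-linear endomorphisms of $K$. -/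

import Mathlib

/-- A `θ`-derivation of `K`: an additive map with `δ (a * b) = θ a * δ b + δ a * b`. -/
structure SkewDerivation {K : Type*} [Field K] (θ : K →+* K) extends K →+ K where
  leibniz' : ∀ a b : K, toFun (a * b) = θ a * toFun b + toFun a * b

namespace SkewDerivation

variable {K : Type*} [Field K] {θ : K →+* K}

instance : CoeFun (SkewDerivation θ) (fun _ => K → K) := ⟨fun δ => δ.toAddMonoidHom⟩

variable (δ : SkewDerivation θ)

theorem leibniz (a b : K) : δ (a * b) = θ a * δ b + δ a * b := δ.leibniz' a b

theorem map_one : δ 1 = 0 := by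
  have h := δ.leibniz 1 1
  simpa using h

/-- The subfield `F` of all `a` in `K` with `θ a = a` and `δ a = 0`. -/
def constants : Subfield K where
  carrier := {a | θ a = a ∧ δ a = 0}
  zero_mem' := ⟨_root_.map_zero θ, _root_.map_zero δ.toAddMonoidHom⟩
  one_mem' := ⟨_root_.map_one θ, δ.map_one⟩
  add_mem' := fun {a b} ha hb =>
    ⟨by rw [_root_.map_add, ha.1, hb.1], by rw [_root_.map_add, ha.2, hb.2, add_zero]⟩
  mul_mem' := fun {a b} ha hb =>
    ⟨by rw [_root_.map_mul, ha.1, hb.1], by rw [δ.leibniz, ha.2, hb.2, mul_zero, zero_mul, add_zero]⟩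
  neg_mem' := fun {a} ha =>
    ⟨by rw [_root_.map_neg, ha.1], by rw [_root_.map_neg, ha.2, neg_zero]⟩
  inv_mem' := fun a ha => by
    refine ⟨by rw [map_inv₀, ha.1], ?_⟩
    by_cases h0 : a = 0
    · simp [h0]
    · have h := δ.leibniz a a⁻¹
      rw [mul_inv_cancel₀ h0, δ.map_one, ha.1, ha.2, zero_mul, add_zero] at h
      exact (mul_eq_zero.mp h.symm).resolve_left h0

theorem mem_constants {a : K} : a ∈ δ.constants ↔ θ a = a ∧ δ a = 0 := Iff.rfl

/-- `c` is ramified when `δ + c θ` is a scalar multiple of the identity of `K`. -/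
def IsRamified (c : K) : Prop := ∃ a : K, ∀ x : K, δ x + c * θ x = a * x

/-- A pseudo-linear endomorphism (with respect to `θ` and `δ`) of a `K`-vector space. -/
structure PseudoLinear (M : Type*) [AddCommGroup M] [Module K M] extends M →+ M where
  map_smul' : ∀ (a : K) (x : M), toFun (a • x) = θ a • toFun x + δ a • x

namespace PseudoLinear

variable {δ} {M : Type*} [AddCommGroup M] [Module K M] (u : δ.PseudoLinear M)

/-- A pseudo-linear endomorphism is `F`-linear. -/
def toEnd : Module.End δ.constants M where
  toFun := u.toFun
  map_add' := u.map_add'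
  map_smul' := fun a x => by
    have h := u.map_smul' (a : K) x
    rw [a.2.1, a.2.2, zero_smul, add_zero] at h
    exact h

theorem toEnd_smul (a : K) (x : M) : u.toEnd (a • x) = θ a • u.toEnd x + δ a • x :=
  u.map_smul' a x

end PseudoLinear

/-- The pseudo-linear endomorphism `δ + c θ` of `K`. -/
def pseudo (c : K) : δ.PseudoLinear K where
  toFun := fun x => δ x + c * θ x
  map_zero' := by simp
  map_add' := fun x y => by simp only [_root_.map_add]; ring
  map_smul' := fun a x => by
    simp only [smul_eq_mul, δ.leibniz, _root_.map_mul]; ring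

end SkewDerivation

/-- The underlying type of `K[X; θ, δ]`: the finitely supported sequence `f` stands for
`∑ i, f i * X ^ i`, with the coefficients on the left. -/
def OrePolynomial {K : Type*} [Field K] {θ : K →+* K} (_δ : SkewDerivation θ) : Type _ := ℕ →₀ K

namespace OrePolynomial

variable {K : Type*} [Field K] {θ : K →+* K} {δ : SkewDerivation θ}

noncomputable instance : AddCommGroup (OrePolynomial δ) := inferInstanceAs (AddCommGroup (ℕ →₀ K))

noncomputable instance : Module K (OrePolynomial δ) := inferInstanceAs (Module K (ℕ →₀ K))

/-- The coefficient of `X ^ i`. -/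
def coeff (f : OrePolynomial δ) (i : ℕ) : K := (show ℕ →₀ K from f) i

/-- The monomial `a X ^ i`. -/
noncomputable def monomial (i : ℕ) (a : K) : OrePolynomial δ :=
  (Finsupp.single i a : ℕ →₀ K)

theorem monomial_add (i : ℕ) (a b : K) :
    (monomial i (a + b) : OrePolynomial δ) = monomial i a + monomial i b :=
  Finsupp.single_add i a b

theorem monomial_zero (i : ℕ) : (monomial i 0 : OrePolynomial δ) = 0 := Finsupp.single_zero i

theorem smul_monomial (i : ℕ) (a b : K) :
    a • (monomial i b : OrePolynomial δ) = monomial i (a * b) := Finsupp.smul_single' a i b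

theorem induction_monomial {p : OrePolynomial δ → Prop} (f : OrePolynomial δ) (h0 : p 0)
    (hadd : ∀ f g, p f → p g → p (f + g)) (hm : ∀ i a, p (monomial i a)) : p f :=
  Finsupp.induction_linear (motive := p) f h0 hadd hm

/-- Evaluation `∑ a_i X ^ i ↦ ∑ a_i u ^ i` at a pseudo-linear endomorphism, as an additive map. -/
noncomputable def evalAux {M : Type*} [AddCommGroup M] [Module K M] (u : δ.PseudoLinear M) :
    OrePolynomial δ →ₗ[K] Module.End δ.constants M :=
  Finsupp.linearCombination K (fun i : ℕ => u.toEnd ^ i)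

theorem evalAux_monomial {M : Type*} [AddCommGroup M] [Module K M] (u : δ.PseudoLinear M)
    (i : ℕ) (a : K) : evalAux u (monomial i a) = a • u.toEnd ^ i :=
  Finsupp.linearCombination_single K a i

/-- Left multiplication by `X`, forced by `X a = θ(a) X + δ(a)`:
`∑ b_j X ^ j ↦ ∑ (θ(b_j) X ^ (j+1) + δ(b_j) X ^ j)`. -/
noncomputable def mulXAux : OrePolynomial δ →+ OrePolynomial δ :=
  Finsupp.liftAddHom (fun j : ℕ =>
    { toFun := fun b : K => (monomial (j + 1) (θ b) + monomial j (δ b) : OrePolynomial δ)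
      map_zero' := by simp [monomial_zero]
      map_add' := fun a b => by
        simp only [_root_.map_add, monomial_add]; abel })

theorem mulXAux_monomial (j : ℕ) (b : K) :
    mulXAux (monomial j b : OrePolynomial δ) = monomial (j + 1) (θ b) + monomial j (δ b) :=
  Finsupp.liftAddHom_apply_single _ j b

/-- Left multiplication by `X` is pseudo-linear. -/
noncomputable def mulX : δ.PseudoLinear (OrePolynomial δ) where
  __ := mulXAux
  map_smul' := fun a f => by
    change mulXAux (a • f) = θ a • mulXAux f + δ a • f
    refine induction_monomial (p := fun f => mulXAux (a • f) = θ a • mulXAux f + δ a • f) f (by simp) (fun f g hf hg => ?_) (fun i b => ?_)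
    · simp only [smul_add, _root_.map_add, hf, hg]; abel
    · simp only [smul_monomial, mulXAux_monomial, smul_add, δ.leibniz, _root_.map_mul,
        monomial_add, add_assoc]

theorem mulX_monomial (j : ℕ) (b : K) :
    mulX.toEnd (monomial j b : OrePolynomial δ) = monomial (j + 1) (θ b) + monomial j (δ b) :=
  mulXAux_monomial j b

/-- The product: `(∑ a_i X ^ i) * g = ∑ a_i (X · (X · ⋯ (X · g)))`. -/
noncomputable instance : Mul (OrePolynomial δ) := ⟨fun f g => evalAux mulX f g⟩

noncomputable instance : One (OrePolynomial δ) := ⟨monomial 0 1⟩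

theorem mul_def (f g : OrePolynomial δ) : f * g = evalAux mulX f g := rfl

theorem one_def : (1 : OrePolynomial δ) = monomial 0 1 := rfl

theorem monomial_mul (i : ℕ) (a : K) (g : OrePolynomial δ) :
    monomial i a * g = a • (mulX.toEnd ^ i) g := by
  rw [mul_def, evalAux_monomial]; rfl

theorem evalAux_one {M : Type*} [AddCommGroup M] [Module K M] (u : δ.PseudoLinear M) :
    evalAux u 1 = 1 := by
  rw [one_def, evalAux_monomial, pow_zero, one_smul]

theorem evalAux_mulX {M : Type*} [AddCommGroup M] [Module K M] (u : δ.PseudoLinear M)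
    (g : OrePolynomial δ) : evalAux u (mulX.toEnd g) = u.toEnd * evalAux u g := by
  refine induction_monomial (p := fun g => evalAux u (mulX.toEnd g) = u.toEnd * evalAux u g) g (by simp) (fun f g hf hg => ?_) (fun i b => ?_)
  · simp only [_root_.map_add, hf, hg, mul_add]
  · rw [mulX_monomial, _root_.map_add]
    simp only [evalAux_monomial]
    ext x
    simp only [LinearMap.add_apply, LinearMap.smul_apply, Module.End.mul_apply, u.toEnd_smul,
      pow_succ']

theorem evalAux_mul {M : Type*} [AddCommGroup M] [Module K M] (u : δ.PseudoLinear M)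
    (f g : OrePolynomial δ) : evalAux u (f * g) = evalAux u f * evalAux u g := by
  refine induction_monomial (p := fun f => evalAux u (f * g) = evalAux u f * evalAux u g) f (by simp [mul_def]) (fun f₁ f₂ h₁ h₂ => ?_) (fun i b => ?_)
  · have h : (f₁ + f₂) * g = f₁ * g + f₂ * g := by simp [mul_def]
    rw [h, _root_.map_add, h₁, h₂, _root_.map_add, add_mul]
  · rw [monomial_mul, _root_.map_smul, evalAux_monomial, smul_mul_assoc]
    congr 1
    induction i with
    | zero => simp
    | succ i ih =>
      rw [pow_succ', Module.End.mul_apply, evalAux_mulX, ih, pow_succ', mul_assoc]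

theorem evalAux_mulX_one (f : OrePolynomial δ) : evalAux mulX f 1 = f := by
  refine induction_monomial (p := fun f => evalAux mulX f 1 = f) f (by simp) (fun f g hf hg => ?_) (fun i b => ?_)
  · rw [_root_.map_add, LinearMap.add_apply, hf, hg]
  · have h : (mulX.toEnd ^ i) (1 : OrePolynomial δ) = monomial i 1 := by
      induction i with
      | zero => rfl
      | succ i ih =>
        rw [pow_succ', Module.End.mul_apply, ih, mulX_monomial]
        simp [δ.map_one, monomial_zero]
    rw [evalAux_monomial, LinearMap.smul_apply, h, smul_monomial, mul_one]

/-- The ring `K[X; θ, δ]`. -/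
noncomputable instance : Ring (OrePolynomial δ) where
  __ := (inferInstance : AddCommGroup (OrePolynomial δ))
  mul_assoc f g h := by
    rw [mul_def (f * g) h, evalAux_mul]; rfl
  one_mul f := by rw [mul_def, evalAux_one]; rfl
  mul_one f := by rw [mul_def, evalAux_mulX_one]
  zero_mul f := by simp [mul_def]
  mul_zero f := by simp [mul_def]
  left_distrib f g h := by simp [mul_def]
  right_distrib f g h := by simp [mul_def]

/-- `K[X; θ, δ]` as an `F`-algebra. -/
noncomputable instance : Algebra δ.constants (OrePolynomial δ) :=
  Algebra.ofModule
    (fun a f g => by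
      change evalAux mulX ((a : K) • f) g = (a : K) • evalAux mulX f g
      rw [_root_.map_smul]; rfl)
    (fun a f g => (evalAux mulX f).map_smul a g)

/-- The inclusion of `K` as the constant polynomials. -/
noncomputable def C : K →+* OrePolynomial δ where
  toFun a := monomial 0 a
  map_one' := rfl
  map_zero' := monomial_zero 0
  map_add' a b := monomial_add 0 a b
  map_mul' a b := by rw [monomial_mul, pow_zero, Module.End.one_apply, smul_monomial]

/-- The variable. -/
noncomputable def X : OrePolynomial δ := monomial 1 1

theorem X_mul_C (a : K) : (X : OrePolynomial δ) * C a = C (θ a) * X + C (δ a) := by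
  change monomial 1 1 * monomial 0 a = monomial 0 (θ a) * monomial 1 1 + monomial 0 (δ a)
  rw [monomial_mul, monomial_mul, pow_one, mulX_monomial, pow_zero, one_smul,
    Module.End.one_apply, smul_monomial, mul_one]

theorem monomial_eq (i : ℕ) (a : K) : (monomial i a : OrePolynomial δ) = C a * X ^ i := by
  have h : (X ^ i : OrePolynomial δ) = monomial i 1 := by
    induction i with
    | zero => rfl
    | succ i ih =>
      rw [pow_succ', ih, X, monomial_mul, pow_one, mulX_monomial, one_smul]
      simp [δ.map_one, monomial_zero]
  rw [h]
  change _ = monomial 0 a * monomial i 1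
  rw [monomial_mul, pow_zero, Module.End.one_apply, smul_monomial, mul_one]

theorem algebraMap_eq (a : δ.constants) :
    algebraMap δ.constants (OrePolynomial δ) a = C (a : K) := by
  rw [Algebra.algebraMap_eq_smul_one]
  change (a : K) • (monomial 0 1 : OrePolynomial δ) = monomial 0 (a : K)
  rw [smul_monomial, mul_one]

/-- Monic: for some `n` the coefficient of `X ^ n` is `1` and all higher ones vanish. -/
def IsMonic (f : OrePolynomial δ) : Prop := ∃ n : ℕ, f.coeff n = 1 ∧ ∀ m, n < m → f.coeff m = 0

/-- Evaluation at `δ + c θ`, the ring homomorphism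
`∑ a_i X ^ i ↦ ∑ a_i (δ + c θ) ^ i` from `K[X; θ, δ]` to `End_F(K)`. -/
noncomputable def ev (c : K) : OrePolynomial δ →+* Module.End δ.constants K where
  toFun := evalAux (δ.pseudo c)
  map_one' := evalAux_one _
  map_zero' := _root_.map_zero _
  map_add' := _root_.map_add _
  map_mul' := evalAux_mul _

theorem ev_C (c a x : K) : ev c (C a : OrePolynomial δ) x = a * x := by
  change evalAux (δ.pseudo c) (monomial 0 a) x = a * x
  rw [evalAux_monomial]; simp

theorem ev_X (c x : K) : ev c (X : OrePolynomial δ) x = δ x + c * θ x := by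
  change evalAux (δ.pseudo c) (monomial 1 1) x = _
  rw [evalAux_monomial, pow_one, one_smul]; rfl

/-- Right Euclidean division by `X - c`; the remainder has degree less than one, so that it is
a constant. -/
theorem existsUnique_rem (f : OrePolynomial δ) (c : K) :
    ∃! r : K, ∃ Q : OrePolynomial δ, f = Q * (X - C c) + C r := by
  have ex : ∃ r : K, ∃ Q : OrePolynomial δ, f = Q * (X - C c) + C r := by
    refine induction_monomial (p := fun f => ∃ r : K, ∃ Q : OrePolynomial δ, f = Q * (X - C c) + C r) f
      ⟨0, 0, by simp⟩ ?_ (fun i a => ?_)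
    · rintro f g ⟨r, Q, hf⟩ ⟨r', Q', hg⟩
      exact ⟨r + r', Q + Q', by
        nth_rewrite 1 [hf, hg]; rw [_root_.map_add, add_mul]; abel⟩
    · rw [monomial_eq]
      have hX : ∃ r : K, ∃ Q : OrePolynomial δ, X ^ i = Q * (X - C c) + C r := by
        induction i with
        | zero => exact ⟨1, 0, by simp⟩
        | succ i ih =>
          obtain ⟨r, Q, h⟩ := ih
          refine ⟨θ r * c + δ r, X * Q + C (θ r), ?_⟩
          rw [pow_succ', h, mul_add, X_mul_C, _root_.map_add, _root_.map_mul]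
          noncomm_ring
      obtain ⟨r, Q, h⟩ := hX
      exact ⟨a * r, C a * Q, by rw [h, mul_add, _root_.map_mul, mul_assoc]⟩
  have key : ∀ (r : K) (Q : OrePolynomial δ), f = Q * (X - C c) + C r → r = ev c f 1 := by
    rintro r Q rfl
    rw [_root_.map_add, _root_.map_mul, _root_.map_sub, LinearMap.add_apply,
      Module.End.mul_apply, LinearMap.sub_apply, ev_C, ev_C, ev_X]
    simp [δ.map_one]
  obtain ⟨r, hr⟩ := ex
  refine ⟨r, hr, ?_⟩
  rintro r' ⟨Q', h'⟩
  obtain ⟨Q, h⟩ := hr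
  rw [key r' Q' h', key r Q h]

/-- The centre of `K[X; θ, δ]`, as an `F`-algebra. -/
noncomputable abbrev zPlus (δ : SkewDerivation θ) : Subalgebra δ.constants (OrePolynomial δ) :=
  Subalgebra.center δ.constants (OrePolynomial δ)

/-- `Z` is monic and the centre of `K[X; θ, δ]` is `F[Z]`. -/
def IsCentralGenerator (Z : zPlus δ) : Prop :=
  IsMonic (Z : OrePolynomial δ) ∧
    Algebra.adjoin δ.constants {(Z : OrePolynomial δ)} = zPlus δ

/-- The remainder of the right Euclidean division of `Z` by `X - c`. -/
noncomputable def upsilon (Z : zPlus δ) (c : K) : K :=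
  (existsUnique_rem (Z : OrePolynomial δ) c).choose

/-- The subring `K[Z]` of `K[X; θ, δ]`, for `Z` central. -/
noncomputable def cPlus (Z : zPlus δ) : Subring (OrePolynomial δ) :=
  Subring.closure (Set.range (C : K →+* OrePolynomial δ) ∪ {(Z : OrePolynomial δ)})

theorem cPlus_mul_comm (Z : zPlus δ) (x y : cPlus Z) : x * y = y * x := by
  have hZ := fun f : OrePolynomial δ => Subalgebra.mem_center_iff.mp Z.2 f
  have h := Subring.isMulCommutative_closure
    (s := Set.range (C : K →+* OrePolynomial δ) ∪ {(Z : OrePolynomial δ)}) (by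
      rintro x (⟨a, rfl⟩ | hx) y (⟨b, rfl⟩ | hy)
      · rw [← _root_.map_mul, mul_comm, _root_.map_mul]
      · rw [Set.mem_singleton_iff.mp hy, hZ]
      · rw [Set.mem_singleton_iff.mp hx, hZ]
      · rw [Set.mem_singleton_iff.mp hy, hZ])
  exact h.is_comm.comm x y

noncomputable instance (Z : zPlus δ) : CommRing (cPlus Z) where
  __ := (inferInstance : Ring (cPlus Z))
  mul_comm := cPlus_mul_comm Z

/-- Right multiplication `x ↦ x f`, a `K[Z]`-linear endomorphism of `K[X; θ, δ]` (seen as a left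
module over `K[Z]`). -/
noncomputable def rightMul (Z : zPlus δ) (f : OrePolynomial δ) :
    OrePolynomial δ →ₗ[cPlus Z] OrePolynomial δ where
  toFun x := x * f
  map_add' x y := add_mul x y f
  map_smul' a x := mul_assoc (a : OrePolynomial δ) x f

/-- The reduced trace of `f`: the trace of `x ↦ x f` over `K[Z]`. -/
noncomputable def reducedTrace (Z : zPlus δ) (f : OrePolynomial δ) : OrePolynomial δ :=
  ((LinearMap.trace (cPlus Z) (OrePolynomial δ) (rightMul Z f) : cPlus Z) : OrePolynomial δ)

end OrePolynomial

/-! Everything follows from the kernel of `ev c`. It is nonzero, since `End_F(K)` has finite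
dimension over `K`, so by right division it consists of the left multiples of a monic `N` of minimal
degree `d`. Minimality forces `N a = θ^d(a) N` and `N X - X N = e N` for some `e` in `K`; when `c`
is unramified this improves to `N` central. For `θ = id` it is enough to compare coefficients.
Otherwise `δ = γ (θ - id)`, and evaluating both relations at `-γ`, where `X + γ` acts as zero, gives
`θ^d = id` and `e = 0`.

Unramifiedness also says that only multiplications by elements of `F` commute with `K` and `δ + c
θ`. So a central polynomial acts on `K` as a scalar of `F`, and successive division by `N` shows
that the centre is `F[N]`. By Jacobson density, `ev c` is onto `End_F(K)`.

For any generator `Z`, `N` is a polynomial in `Z` over `F`. Hence the Ore ring is finite over the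
principal ideal domain `K[Z]`, and free because torsion-free. The kernel of `ev c` is generated by
`Z - υ(c)`, so reducing `x ↦ x f` modulo this element gives precomposition with `ev c f` on
`End_F(K)`, whose trace over `K` is `Tr(ev c f)`.

The reduced trace commutes with `K` since `K[Z]` is commutative. It commutes with `X` because left
multiplication by `X` (a connection, if `θ = id`) or by `X + γ` (semilinear, otherwise) commutes
with right multiplications. -/

namespace OrePolynomial

variable {K : Type*} [Field K] {θ : K →+* K} {δ : SkewDerivation θ}

/-! ### Coefficients, degrees and Euclidean division -/

theorem coeff_zero (i : ℕ) : (0 : OrePolynomial δ).coeff i = 0 := rfl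

theorem coeff_add (f g : OrePolynomial δ) (i : ℕ) : (f + g).coeff i = f.coeff i + g.coeff i := rfl

theorem coeff_sub (f g : OrePolynomial δ) (i : ℕ) : (f - g).coeff i = f.coeff i - g.coeff i := rfl

theorem coeff_smul (a : K) (f : OrePolynomial δ) (i : ℕ) : (a • f).coeff i = a * f.coeff i := rfl

theorem coeff_monomial (i j : ℕ) (a : K) :
    (monomial i a : OrePolynomial δ).coeff j = if i = j then a else 0 :=
  Finsupp.single_apply

theorem ext_coeff {f g : OrePolynomial δ} (h : ∀ i, f.coeff i = g.coeff i) : f = g :=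
  Finsupp.ext h

theorem C_mul (a : K) (f : OrePolynomial δ) : C a * f = a • f := by
  change monomial 0 a * f = a • f
  rw [monomial_mul, pow_zero, Module.End.one_apply]

theorem X_mul (f : OrePolynomial δ) : X * f = mulX.toEnd f := by
  rw [X, monomial_mul, pow_one, one_smul]

theorem coeff_X_mul_succ (f : OrePolynomial δ) (i : ℕ) :
    (X * f).coeff (i + 1) = θ (f.coeff i) + δ (f.coeff (i + 1)) := by
  rw [X_mul]
  refine induction_monomial (p := fun f => (mulX.toEnd f).coeff (i + 1) =
    θ (f.coeff i) + δ (f.coeff (i + 1))) f ?_ ?_ ?_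
  · simp only [_root_.map_zero, coeff_zero, add_zero]
  · intro f g hf hg
    simp only [_root_.map_add, coeff_add, hf, hg]
    abel
  · intro j a
    rw [mulX_monomial, coeff_add]
    simp only [coeff_monomial, Nat.add_right_cancel_iff]
    split_ifs <;> simp

theorem monomial_mul_X (i : ℕ) (a : K) :
    (monomial i a : OrePolynomial δ) * X = monomial (i + 1) a := by
  rw [monomial_eq, monomial_eq, mul_assoc, pow_succ]

theorem coeff_mul_X_succ (f : OrePolynomial δ) (i : ℕ) : (f * X).coeff (i + 1) = f.coeff i := by
  refine induction_monomial (p := fun f => (f * X).coeff (i + 1) = f.coeff i) f ?_ ?_ ?_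
  · rw [zero_mul, coeff_zero, coeff_zero]
  · intro f g hf hg
    rw [add_mul, coeff_add, coeff_add, hf, hg]
  · intro j a
    rw [monomial_mul_X, coeff_monomial, coeff_monomial]
    simp only [Nat.add_right_cancel_iff]

variable (δ) in
/-- The Ore polynomials of degree less than `m`. -/
def degLT (m : ℕ) : Submodule K (OrePolynomial δ) where
  carrier := {f | ∀ k, m ≤ k → f.coeff k = 0}
  zero_mem' := fun _ _ => rfl
  add_mem' := fun {f g} hf hg k hk => by rw [coeff_add, hf k hk, hg k hk, add_zero]
  smul_mem' := fun a f hf k hk => by rw [coeff_smul, hf k hk, mul_zero]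

theorem degLT_mono {m n : ℕ} (h : m ≤ n) : degLT δ m ≤ degLT δ n :=
  fun _ hf k hk => hf k (h.trans hk)

theorem eq_zero_of_mem_degLT_zero {f : OrePolynomial δ} (h : f ∈ degLT δ 0) : f = 0 :=
  ext_coeff fun i => h i (Nat.zero_le i)

theorem mem_degLT_of_succ {m : ℕ} {f : OrePolynomial δ} (h : f ∈ degLT δ (m + 1))
    (h0 : f.coeff m = 0) : f ∈ degLT δ m := fun k hk => by
  rcases hk.eq_or_lt with rfl | hk
  · exact h0
  · exact h k hk

theorem exists_mem_degLT (f : OrePolynomial δ) : ∃ m, f ∈ degLT δ m := by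
  refine induction_monomial (p := fun f => ∃ m, f ∈ degLT δ m) f ⟨0, Submodule.zero_mem _⟩ ?_ ?_
  · rintro f g ⟨m, hf⟩ ⟨n, hg⟩
    exact ⟨max m n, Submodule.add_mem _ (degLT_mono (le_max_left m n) hf)
      (degLT_mono (le_max_right m n) hg)⟩
  · intro i a
    refine ⟨i + 1, fun k hk => ?_⟩
    rw [coeff_monomial, if_neg (by omega)]

theorem exists_leading {f : OrePolynomial δ} (hf : f ≠ 0) :
    ∃ m, f ∈ degLT δ (m + 1) ∧ f.coeff m ≠ 0 := by
  obtain ⟨m, hm⟩ := exists_mem_degLT f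
  induction m with
  | zero => exact absurd (eq_zero_of_mem_degLT_zero hm) hf
  | succ m ih =>
    by_cases h0 : f.coeff m = 0
    · exact ih (mem_degLT_of_succ hm h0)
    · exact ⟨m, hm, h0⟩

theorem monomial_mem_degLT {i m : ℕ} (h : i < m) (a : K) :
    (monomial i a : OrePolynomial δ) ∈ degLT δ m := fun k hk => by
  rw [coeff_monomial, if_neg (by omega)]

theorem sub_monomial_mem_degLT {m : ℕ} {f : OrePolynomial δ} (h : f ∈ degLT δ (m + 1)) :
    f - monomial m (f.coeff m) ∈ degLT δ m := by
  refine mem_degLT_of_succ (Submodule.sub_mem _ h (monomial_mem_degLT m.lt_succ_self _)) ?_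
  rw [coeff_sub, coeff_monomial, if_pos rfl, sub_self]

theorem X_mul_mem_degLT {m : ℕ} {f : OrePolynomial δ} (h : f ∈ degLT δ m) :
    X * f ∈ degLT δ (m + 1) := fun k hk => by
  obtain ⟨k, rfl⟩ := Nat.exists_eq_add_of_le' (Nat.le_of_add_left_le hk)
  rw [coeff_X_mul_succ, h k (by omega), h (k + 1) (by omega), _root_.map_zero, _root_.map_zero,
    add_zero]

theorem mul_X_mem_degLT {m : ℕ} {f : OrePolynomial δ} (h : f ∈ degLT δ m) :
    f * X ∈ degLT δ (m + 1) := fun k hk => by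
  obtain ⟨k, rfl⟩ := Nat.exists_eq_add_of_le' (Nat.le_of_add_left_le hk)
  rw [coeff_mul_X_succ, h k (by omega)]

theorem X_pow_mul_mem_degLT {n : ℕ} {g : OrePolynomial δ} (h : g ∈ degLT δ n) (i : ℕ) :
    X ^ i * g ∈ degLT δ (i + n) := by
  induction i with
  | zero => simpa using h
  | succ i ih =>
    rw [pow_succ', mul_assoc, Nat.succ_add]
    exact X_mul_mem_degLT ih

theorem coeff_X_pow_mul {n : ℕ} {g : OrePolynomial δ} (h : g ∈ degLT δ (n + 1)) (i : ℕ) :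
    (X ^ i * g).coeff (i + n) = (θ ^ i) (g.coeff n) := by
  induction i with
  | zero => simp
  | succ i ih =>
    rw [pow_succ', mul_assoc, Nat.succ_add, coeff_X_mul_succ, ih,
      X_pow_mul_mem_degLT h i (i + n + 1) le_rfl, _root_.map_zero, add_zero, pow_succ']
    rfl

theorem mul_mem_degLT {m n : ℕ} {f g : OrePolynomial δ} (hf : f ∈ degLT δ (m + 1))
    (hg : g ∈ degLT δ (n + 1)) : f * g ∈ degLT δ (m + n + 1) := by
  induction m generalizing f with
  | zero =>
    have h := eq_zero_of_mem_degLT_zero (sub_monomial_mem_degLT hf)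
    rw [sub_eq_zero] at h
    rw [h, monomial_mul, pow_zero, Nat.zero_add]
    exact Submodule.smul_mem _ _ hg
  | succ m ih =>
    have h : f * g = (f - monomial (m + 1) (f.coeff (m + 1))) * g
        + f.coeff (m + 1) • (X ^ (m + 1) * g) := by
      rw [sub_mul, monomial_eq, mul_assoc, C_mul, sub_add_cancel]
    rw [h]
    exact Submodule.add_mem _ (degLT_mono (by omega) (ih (sub_monomial_mem_degLT hf)))
      (Submodule.smul_mem _ _ (X_pow_mul_mem_degLT hg _))

theorem coeff_mul {m n : ℕ} {f g : OrePolynomial δ} (hf : f ∈ degLT δ (m + 1))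
    (hg : g ∈ degLT δ (n + 1)) : (f * g).coeff (m + n) = f.coeff m * (θ ^ m) (g.coeff n) := by
  have h : f * g = (f - monomial m (f.coeff m)) * g + f.coeff m • (X ^ m * g) := by
    rw [sub_mul, monomial_eq, mul_assoc, C_mul, sub_add_cancel]
  rw [h, coeff_add, coeff_smul, coeff_X_pow_mul hg]
  have hz : ((f - monomial m (f.coeff m)) * g).coeff (m + n) = 0 := by
    have h' := sub_monomial_mem_degLT hf
    cases m with
    | zero => rw [eq_zero_of_mem_degLT_zero h', zero_mul, coeff_zero]
    | succ m => exact mul_mem_degLT h' hg _ (by omega)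
  rw [hz, zero_add]

instance : Nontrivial (OrePolynomial δ) :=
  ⟨⟨1, 0, fun h => by
    have h1 := congrArg (fun f : OrePolynomial δ => f.coeff 0) h
    simp only [one_def, coeff_monomial, if_true, coeff_zero] at h1
    exact one_ne_zero h1⟩⟩

/-- Leading coefficients `a` in degree `m` and `b` multiply to `a θ^m(b)`, which is nonzero because
`θ` is injective. -/
instance : NoZeroDivisors (OrePolynomial δ) where
  eq_zero_or_eq_zero_of_mul_eq_zero {f g} h := by
    by_contra! hne
    obtain ⟨m, hm, hm0⟩ := exists_leading hne.1
    obtain ⟨n, hn, hn0⟩ := exists_leading hne.2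
    have h1 := coeff_mul hm hn
    rw [h, coeff_zero] at h1
    exact mul_ne_zero hm0 ((_root_.map_ne_zero (θ ^ m)).mpr hn0) h1.symm

/-- Right Euclidean division by a monic `N` of degree `d`. -/
theorem exists_eq_mul_add {N : OrePolynomial δ} {d : ℕ} (hN : N ∈ degLT δ (d + 1))
    (hN1 : N.coeff d = 1) (m : ℕ) (f : OrePolynomial δ) (hf : f ∈ degLT δ m) :
    ∃ q ∈ degLT δ (m - d), ∃ s ∈ degLT δ d, f = q * N + s := by
  induction m generalizing f with
  | zero => exact ⟨0, Submodule.zero_mem _, f, degLT_mono (Nat.zero_le d) hf, by simp⟩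
  | succ m ih =>
    by_cases hmd : m < d
    · exact ⟨0, Submodule.zero_mem _, f, degLT_mono hmd hf, by simp⟩
    push Not at hmd
    obtain ⟨k, rfl⟩ := Nat.exists_eq_add_of_le' hmd
    have hM := monomial_mem_degLT (δ := δ) k.lt_succ_self (f.coeff (k + d))
    -- As `N` is monic, subtracting this left multiple cancels the top coefficient of `f`.
    obtain ⟨q, hq, s, hs, h⟩ := ih (f - monomial k (f.coeff (k + d)) * N) (by
      refine mem_degLT_of_succ (Submodule.sub_mem _ hf (mul_mem_degLT hM hN)) ?_
      rw [coeff_sub, coeff_mul hM hN, hN1, coeff_monomial, if_pos rfl, _root_.map_one, mul_one,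
        sub_self])
    refine ⟨q + monomial k (f.coeff (k + d)), ?_, s, hs, ?_⟩
    · exact Submodule.add_mem _ (degLT_mono (by omega) hq) (degLT_mono (by omega) hM)
    · rw [add_mul, add_right_comm, ← h, sub_add_cancel]

theorem mem_zPlus_of_commute {f : OrePolynomial δ} (hC : ∀ a, C a * f = f * C a)
    (hX : X * f = f * X) : f ∈ zPlus δ := by
  refine Subalgebra.mem_center_iff.mpr fun g => ?_
  refine induction_monomial (p := fun g => g * f = f * g) g (by simp) ?_ ?_
  · intro g h hg hh
    rw [add_mul, mul_add, hg, hh]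
  · intro i a
    rw [monomial_eq, mul_assoc, (Commute.pow_left (show Commute X f from hX) i).eq, ← mul_assoc,
      hC, mul_assoc]

end OrePolynomial

/-! ### The shape of `θ` and `δ` -/

namespace SkewDerivation

variable {K : Type*} [Field K] {θ : K →+* K} (δ : SkewDerivation θ)

/-- If `θ ≠ id`, the derivation `δ` is inner. -/
theorem exists_inner (hθ : θ ≠ RingHom.id K) : ∃ γ : K, ∀ a, δ a = γ * (θ a - a) := by
  obtain ⟨b, hb⟩ : ∃ b, θ b ≠ b := by
    by_contra! h
    exact hθ (RingHom.ext h)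
  have hb' : θ b - b ≠ 0 := sub_ne_zero.mpr hb
  refine ⟨δ b / (θ b - b), fun a => ?_⟩
  -- Commutativity of `K`: `δ (a b)` and `δ (b a)` are expanded by the Leibniz rule.
  have h : θ a * δ b + δ a * b = θ b * δ a + δ b * a := by
    rw [← δ.leibniz, ← δ.leibniz, mul_comm]
  field_simp
  linear_combination -h

theorem surjective_theta [FiniteDimensional δ.constants K] : Function.Surjective θ := by
  let l : K →ₗ[δ.constants] K :=
    { toFun := θ
      map_add' := _root_.map_add θ
      map_smul' := fun a x => by
        change θ ((a : K) * x) = (a : K) * θ x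
        rw [_root_.map_mul, a.2.1] }
  exact LinearMap.surjective_of_injective (f := l) θ.injective

end SkewDerivation

/-! ### The kernel of `ev c` and the centre -/

namespace OrePolynomial

variable {K : Type*} [Field K] {θ : K →+* K} {δ : SkewDerivation θ}

theorem ev_smul (c a : K) (f : OrePolynomial δ) : ev c (a • f) = a • ev c f :=
  _root_.map_smul (evalAux (δ.pseudo c)) a f

/-- If `δ + c θ` is not scalar, an endomorphism of `K` commuting with it and with `K` is given by
multiplication by an element of `F`. -/
theorem mem_constants_of_commute {c : K} (hc : ¬ δ.IsRamified c) {g : K → K}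
    (hC : ∀ a x, g (a * x) = a * g x) (hX : ∀ x, g (δ x + c * θ x) = δ (g x) + c * θ (g x)) :
    g 1 ∈ δ.constants := by
  have hg : ∀ x, g x = g 1 * x := fun x => by
    have := hC x 1
    rwa [mul_one, mul_comm] at this
  generalize g 1 = a at hg
  -- If `θ a ≠ a`, dividing this identity by `θ a - a` would make `δ + c θ` scalar.
  have h : ∀ x, (θ a - a) * (δ x + c * θ x) = -(δ a * x) := fun x => by
    have := hX x
    rw [hg, hg, δ.leibniz, _root_.map_mul] at this
    linear_combination -this
  have h0 : θ a - a = 0 := by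
    by_contra h0
    exact hc ⟨-δ a / (θ a - a), fun x => by
      field_simp
      linear_combination h x⟩
  refine ⟨sub_eq_zero.mp h0, ?_⟩
  have := h 1
  rw [h0] at this
  linear_combination this

theorem ev_central {c : K} (hc : ¬ δ.IsRamified c) {z : OrePolynomial δ} (hz : z ∈ zPlus δ) :
    ev c z 1 ∈ δ.constants ∧ ∀ x, ev c z x = ev c z 1 * x := by
  have hC : ∀ a x, ev c z (a * x) = a * ev c z x := fun a x => by
    have h := congrArg (fun f => ev c f x) (Subalgebra.mem_center_iff.mp hz (C a))
    simp only [_root_.map_mul, Module.End.mul_apply, ev_C] at h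
    exact h.symm
  refine ⟨mem_constants_of_commute hc hC fun x => ?_, fun x => ?_⟩
  · have h := congrArg (fun f => ev c f x) (Subalgebra.mem_center_iff.mp hz X)
    simp only [_root_.map_mul, Module.End.mul_apply, ev_X] at h
    exact h.symm
  · rw [mul_comm, ← hC, mul_one]

/-- A `K`-linear map from a space of infinite dimension to one of finite dimension cannot be
injective. -/
theorem exists_ev_eq_zero [FiniteDimensional δ.constants K] (c : K) :
    ∃ f : OrePolynomial δ, f ≠ 0 ∧ ev c f = 0 := by
  by_contra! h
  have hinj : Function.Injective (evalAux (δ.pseudo c)) := by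
    rw [← LinearMap.ker_eq_bot, LinearMap.ker_eq_bot']
    intro f hf
    by_contra hne
    exact h f hne hf
  have : Module.Finite K (Module.End δ.constants K) :=
    Module.Finite.of_restrictScalars_finite δ.constants K _
  have hfin : Module.Finite K (ℕ →₀ K) := Module.Finite.of_injective _ hinj
  rcases Module.finite_finsupp_self_iff.mp hfin with h | h
  · exact not_subsingleton K h
  · exact not_finite ℕ

/-- `N` is the monic generator, of degree `d`, of the kernel of `ev c`. -/
structure IsKernelGenerator (c : K) (N : OrePolynomial δ) (d : ℕ) : Prop where
  mem_deg : N ∈ degLT δ (d + 1)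
  leading : N.coeff d = 1
  ev_eq_zero : ev c N = 0
  eq_zero : ∀ f ∈ degLT δ d, ev c f = 0 → f = 0

theorem exists_isKernelGenerator [FiniteDimensional δ.constants K] (c : K) :
    ∃ (N : OrePolynomial δ) (d : ℕ), IsKernelGenerator c N d := by
  classical
  have hex : ∃ d, ∃ f ∈ degLT δ (d + 1), f.coeff d ≠ 0 ∧ ev c f = 0 := by
    obtain ⟨f, hf, hf0⟩ := exists_ev_eq_zero (δ := δ) c
    obtain ⟨m, hm, hm0⟩ := exists_leading hf
    exact ⟨m, f, hm, hm0, hf0⟩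
  obtain ⟨f, hf, hf0, hfe⟩ := Nat.find_spec hex
  refine ⟨(f.coeff (Nat.find hex))⁻¹ • f, Nat.find hex, Submodule.smul_mem _ _ hf, ?_, ?_, ?_⟩
  · rw [coeff_smul, inv_mul_cancel₀ hf0]
  · rw [ev_smul, hfe, smul_zero]
  · intro g hg hge
    by_contra hne
    obtain ⟨m, hm, hm0⟩ := exists_leading hne
    have hlt : m < Nat.find hex := by
      by_contra! h
      exact hm0 (hg m h)
    exact Nat.find_min hex hlt ⟨g, hm, hm0, hge⟩

namespace IsKernelGenerator

variable {c : K} {N : OrePolynomial δ} {d : ℕ} (hN : IsKernelGenerator c N d)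
include hN

theorem ne_zero : N ≠ 0 := fun h => by
  have := hN.leading
  rw [h, coeff_zero] at this
  exact zero_ne_one this

theorem pos : 0 < d := by
  rcases Nat.eq_zero_or_pos d with rfl | h
  · have h1 : N = 1 := by
      have := eq_zero_of_mem_degLT_zero (sub_monomial_mem_degLT hN.mem_deg)
      rw [hN.leading, ← one_def] at this
      exact sub_eq_zero.mp this
    have h2 := congrArg (fun g => g 1) hN.ev_eq_zero
    rw [h1] at h2
    simp at h2
  · exact h

/-- The difference of the two sides is killed by `ev c` and has degree less than `d`, so it vanishes
by minimality. -/
theorem mul_C (a : K) : N * C a = C ((θ ^ d) a) * N := by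
  have hC : (C a : OrePolynomial δ) ∈ degLT δ (0 + 1) := monomial_mem_degLT Nat.one_pos a
  rw [C_mul, ← sub_eq_zero]
  refine hN.eq_zero _ (mem_degLT_of_succ (Submodule.sub_mem _ (mul_mem_degLT hN.mem_deg hC)
    (Submodule.smul_mem _ _ hN.mem_deg)) ?_) ?_
  · have h := coeff_mul hN.mem_deg hC
    rw [add_zero] at h
    rw [coeff_sub, h, coeff_smul, hN.leading]
    change 1 * (θ ^ d) ((monomial 0 a : OrePolynomial δ).coeff 0) - _ = 0
    rw [coeff_monomial, if_pos rfl]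
    ring
  · rw [_root_.map_sub, _root_.map_mul, ev_smul, hN.ev_eq_zero, smul_zero, zero_mul, sub_zero]

/-- The terms of degree `d + 1` cancel, so the commutator is an element of the kernel of degree at
most `d`. Minimality makes it a left `K`-multiple of `N`. -/
theorem exists_commutator_eq : ∃ e : K, N * X - X * N = C e * N := by
  have hm : N * X - X * N ∈ degLT δ (d + 1) := by
    refine mem_degLT_of_succ (Submodule.sub_mem _ (mul_X_mem_degLT hN.mem_deg)
      (X_mul_mem_degLT hN.mem_deg)) ?_
    rw [coeff_sub, coeff_mul_X_succ, coeff_X_mul_succ, hN.leading, hN.mem_deg _ le_rfl,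
      _root_.map_one, _root_.map_zero, add_zero, sub_self]
  refine ⟨(N * X - X * N).coeff d, ?_⟩
  rw [C_mul, ← sub_eq_zero]
  refine hN.eq_zero _ (mem_degLT_of_succ (Submodule.sub_mem _ hm
    (Submodule.smul_mem _ _ hN.mem_deg)) ?_) ?_
  · rw [coeff_sub _ (_ • _), coeff_smul, hN.leading, mul_one, sub_self]
  · rw [_root_.map_sub, ev_smul, _root_.map_sub, _root_.map_mul, _root_.map_mul, hN.ev_eq_zero]
    simp

theorem mem_zPlus_of_eq_id (hθ : θ = RingHom.id K) : N ∈ zPlus δ := by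
  subst hθ
  refine mem_zPlus_of_commute (fun a => ?_) ?_
  · rw [hN.mul_C]
    congr 2
    induction d with
    | zero => rfl
    | succ d ih => simp
  · obtain ⟨e, he⟩ := hN.exists_commutator_eq
    -- The coefficient of `X ^ d` in `N X - X N` is `-δ 1 = 0`, while in `e N` it is `e`.
    have h := congrArg (fun f => f.coeff d) he
    obtain ⟨k, rfl⟩ := Nat.exists_eq_add_of_le' hN.pos
    simp only [C_mul, coeff_sub, coeff_smul, hN.leading, coeff_mul_X_succ, coeff_X_mul_succ,
      RingHom.id_apply, δ.map_one] at h
    have he0 : e = 0 := by linear_combination -h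
    rw [he0, _root_.map_zero, zero_mul, sub_eq_zero] at he
    exact he.symm

theorem mem_zPlus_of_inner [FiniteDimensional δ.constants K] (hc : ¬ δ.IsRamified c) {γ : K}
    (hγ : ∀ a, δ a = γ * (θ a - a)) : N ∈ zPlus δ := by
  have hY : ∀ x, ev (-γ) (X + C γ : OrePolynomial δ) x = 0 := fun x => by
    rw [_root_.map_add, LinearMap.add_apply, ev_X, ev_C, hγ]
    ring
  obtain ⟨n, Q, hQ⟩ := (existsUnique_rem N (-γ)).exists
  rw [_root_.map_neg, sub_neg_eq_add] at hQ
  have hn : ∀ x, ev (-γ) N x = n * x := fun x => by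
    rw [hQ, _root_.map_add, _root_.map_mul, LinearMap.add_apply, Module.End.mul_apply, hY,
      _root_.map_zero, ev_C, zero_add]
  -- If `n = 0`, then `N = Q (X + γ)`. Under `ev c` the factor `X + γ` becomes `(c + γ) θ`, which is
  -- onto, so `Q` would be a kernel element of degree less than `d`.
  have hn0 : n ≠ 0 := by
    rintro rfl
    rw [_root_.map_zero, add_zero] at hQ
    have hcγ : c + γ ≠ 0 := fun h => hc ⟨-γ, fun x => by
      rw [hγ]
      linear_combination θ x * h⟩
    have hQe : ev c Q = 0 := by
      ext x
      obtain ⟨y, hy⟩ := δ.surjective_theta (x / (c + γ))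
      have h := congrArg (fun g => g y) hN.ev_eq_zero
      have hx : ev c (X + C γ : OrePolynomial δ) y = x := by
        rw [_root_.map_add, LinearMap.add_apply, ev_X, ev_C, hγ, hy]
        field_simp
        ring
      simp only [hQ, _root_.map_mul, Module.End.mul_apply, hx] at h
      exact h
    have hQ0 : Q ≠ 0 := by
      rintro rfl
      exact hN.ne_zero (by rw [hQ, zero_mul])
    obtain ⟨m, hm, hm0⟩ := exists_leading hQ0
    have h1 : N.coeff (m + 1) = Q.coeff m := by
      rw [hQ, mul_add, coeff_add, coeff_mul_X_succ, add_eq_left]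
      have hC : (C γ : OrePolynomial δ) ∈ degLT δ (0 + 1) := monomial_mem_degLT Nat.one_pos γ
      exact mul_mem_degLT hm hC _ le_rfl
    have hmd : m + 1 ≤ d := by
      by_contra! h
      exact hm0 (h1.symm.trans (hN.mem_deg _ h))
    exact hQ0 (hN.eq_zero Q (degLT_mono hmd hm) hQe)
  have hθ : ∀ a, (θ ^ d) a = a := fun a => by
    have h := congrArg (fun f => ev (-γ) f 1) (hN.mul_C a)
    simp only [_root_.map_mul, Module.End.mul_apply, ev_C, hn, mul_one] at h
    rw [mul_comm] at h
    exact (mul_right_cancel₀ hn0 h).symm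
  have hC : ∀ a, C a * N = N * C a := fun a => by rw [hN.mul_C, hθ]
  refine mem_zPlus_of_commute hC ?_
  obtain ⟨e, he⟩ := hN.exists_commutator_eq
  -- Replacing `X` by `X + γ` leaves the commutator unchanged, as `N` commutes with constants.
  -- Evaluation at `-γ` then kills the left side and turns the right side into `e n`.
  have he' : N * (X + C γ) - (X + C γ) * N = C e * N := by
    rw [mul_add, add_mul, hC, add_sub_add_right_eq_sub, he]
  have h := congrArg (fun f => ev (-γ) f 1) he'
  simp only [_root_.map_sub, _root_.map_mul, LinearMap.sub_apply, Module.End.mul_apply, hY, ev_C,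
    hn, mul_zero, mul_one, sub_zero] at h
  have he0 : e = 0 := (mul_eq_zero.mp h.symm).resolve_right hn0
  rw [he0, _root_.map_zero, zero_mul, sub_eq_zero] at he
  exact he.symm

theorem mem_zPlus [FiniteDimensional δ.constants K] (hc : ¬ δ.IsRamified c) : N ∈ zPlus δ := by
  by_cases hθ : θ = RingHom.id K
  · exact hN.mem_zPlus_of_eq_id hθ
  · obtain ⟨γ, hγ⟩ := δ.exists_inner hθ
    exact hN.mem_zPlus_of_inner hc hγ

theorem eq_mul_of_ev_eq_zero {f : OrePolynomial δ} (hf : ev c f = 0) :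
    ∃ q, f = q * N := by
  obtain ⟨m, hm⟩ := exists_mem_degLT f
  obtain ⟨q, -, s, hs, rfl⟩ := exists_eq_mul_add hN.mem_deg hN.leading m f hm
  rw [_root_.map_add, _root_.map_mul, hN.ev_eq_zero, mul_zero, zero_add] at hf
  exact ⟨q, by rw [hN.eq_zero s hs hf, add_zero]⟩

/-- Induction on the degree. In `f = q N + s`, the action of `s` on `K` is that of `f`, a scalar of
`F`; since `s` has degree less than `d`, it is that scalar. Then `q N` is central, and cancelling
`N` makes `q` central, of smaller degree because `d > 0`. -/
theorem mem_adjoin (hc : ¬ δ.IsRamified c) (hz : N ∈ zPlus δ) (m : ℕ) (f : OrePolynomial δ)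
    (hf : f ∈ zPlus δ) (hm : f ∈ degLT δ m) : f ∈ Algebra.adjoin δ.constants {N} := by
  induction m generalizing f with
  | zero => rw [eq_zero_of_mem_degLT_zero hm]; exact Subalgebra.zero_mem _
  | succ m ih =>
    obtain ⟨q, hq, s, hs, h⟩ := exists_eq_mul_add hN.mem_deg hN.leading (m + 1) f hm
    obtain ⟨h1, h2⟩ := ev_central hc hf
    have hsC : s = algebraMap δ.constants _ ⟨_, h1⟩ := by
      rw [algebraMap_eq, ← sub_eq_zero]
      refine hN.eq_zero _ (Submodule.sub_mem _ hs (monomial_mem_degLT hN.pos _)) ?_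
      ext x
      have h3 : ev c f = ev c s := by
        rw [h, _root_.map_add, _root_.map_mul, hN.ev_eq_zero, mul_zero, zero_add]
      rw [_root_.map_sub, LinearMap.sub_apply, ev_C, ← h3, h2, sub_self, LinearMap.zero_apply]
    have hqz : q ∈ zPlus δ := by
      have hqN : q * N ∈ zPlus δ := by
        rw [eq_sub_of_add_eq h.symm, hsC]
        exact Subalgebra.sub_mem _ hf (Subalgebra.algebraMap_mem _ _)
      refine Subalgebra.mem_center_iff.mpr fun g => mul_right_cancel₀ hN.ne_zero ?_
      rw [mul_assoc, Subalgebra.mem_center_iff.mp hqN g, mul_assoc, mul_assoc,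
        Subalgebra.mem_center_iff.mp hz g]
    rw [h, hsC]
    exact Subalgebra.add_mem _ (Subalgebra.mul_mem _
      (ih q hqz (degLT_mono (by have := hN.pos; omega) hq)) (Algebra.self_mem_adjoin_singleton _ _)) (Subalgebra.algebraMap_mem _ _)

theorem isCentralGenerator (hc : ¬ δ.IsRamified c) (hz : N ∈ zPlus δ) :
    IsCentralGenerator ⟨N, hz⟩ := by
  refine ⟨⟨d, hN.leading, fun m hm => hN.mem_deg m hm⟩, le_antisymm ?_ fun f hf => ?_⟩
  · exact Algebra.adjoin_le (Set.singleton_subset_iff.mpr hz)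
  · obtain ⟨m, hm⟩ := exists_mem_degLT f
    exact hN.mem_adjoin hc hz m f hf hm

end IsKernelGenerator

end OrePolynomial

/-! ### Traces over a commutative ring -/

section Trace

variable {R M ι : Type*} [CommRing R] [AddCommGroup M] [Module R M] [Fintype ι]

theorem Module.Basis.trace_eq_sum_repr (b : Module.Basis ι R M) (L : M →ₗ[R] M) :
    LinearMap.trace R M L = ∑ i, b.repr (L (b i)) i := by
  classical
  rw [LinearMap.trace_eq_matrix_trace R b, Matrix.trace]
  exact Finset.sum_congr rfl fun i _ => LinearMap.toMatrix_apply _ _ _ _ _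

/-- The trace of an endomorphism commuting with an injective semilinear map is fixed. -/
theorem LinearMap.map_trace_of_commute_semilinear [IsDomain R] (b : Module.Basis ι R M)
    (τ : R →+ R) (hτ : Function.Surjective τ) (D : M →+ M) (hD : ∀ r m, D (r • m) = τ r • D m)
    (hinj : Function.Injective D) (L : M →ₗ[R] M) (hL : ∀ m, L (D m) = D (L m)) :
    τ (LinearMap.trace R M L) = LinearMap.trace R M L := by
  classical
  have hsum : ∀ m, D m = ∑ k, τ (b.repr m k) • D (b k) := fun m => by
    conv_lhs => rw [← b.sum_repr m]
    rw [_root_.map_sum]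
    exact Finset.sum_congr rfl fun k _ => hD _ _
  set A : Matrix ι ι R := LinearMap.toMatrix b b L with hA
  set B : Matrix ι ι R := Matrix.of fun i j => b.repr (D (b j)) i with hB
  have hAapp : ∀ i j, A i j = b.repr (L (b j)) i := fun i j => LinearMap.toMatrix_apply _ _ _ _ _
  have hAB : A * B = B * A.map τ := by
    ext i j
    have h1 : b.repr (L (D (b j))) i = ∑ k, A i k * B k j := by
      conv_lhs => rw [← b.sum_repr (D (b j))]
      simp only [_root_.map_sum, _root_.map_smul, Finsupp.coe_finsetSum, Finset.sum_apply,
        Finsupp.smul_apply, smul_eq_mul, hAapp, hB, Matrix.of_apply]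
      exact Finset.sum_congr rfl fun k _ => mul_comm _ _
    have h2 : b.repr (D (L (b j))) i = ∑ k, B i k * τ (A k j) := by
      rw [hsum]
      simp only [_root_.map_sum, _root_.map_smul, Finsupp.coe_finsetSum, Finset.sum_apply,
        Finsupp.smul_apply, smul_eq_mul, hAapp, hB, Matrix.of_apply]
      exact Finset.sum_congr rfl fun k _ => mul_comm _ _
    rw [Matrix.mul_apply, Matrix.mul_apply, ← h1, hL, h2]
    rfl
  -- Surjectivity of `τ` lifts a vector of the kernel of `B` to coordinates of an element killed by
  -- `D`.
  have hdet : B.det ≠ 0 := fun h0 => by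
    obtain ⟨v, hv, hBv⟩ := Matrix.exists_mulVec_eq_zero_iff.mpr h0
    choose w hw using fun i => hτ (v i)
    have hz : D (∑ k, w k • b k) = 0 := by
      rw [_root_.map_sum]
      simp only [hD, hw]
      refine b.ext_elem fun i => ?_
      have := congrFun hBv i
      simp only [_root_.map_sum, _root_.map_smul, Finsupp.coe_finsetSum, Finset.sum_apply,
        Finsupp.smul_apply, smul_eq_mul, _root_.map_zero, Finsupp.zero_apply]
      rw [Matrix.mulVec, dotProduct, Pi.zero_apply] at this
      rw [← this]
      exact Finset.sum_congr rfl fun k _ => mul_comm _ _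
    have hw0 := Fintype.linearIndependent_iff.mp b.linearIndependent w
      (hinj (hz.trans (_root_.map_zero D).symm))
    exact hv (funext fun i => by rw [← hw i, hw0 i, _root_.map_zero, Pi.zero_apply])
  -- `B` need not be invertible over `R`, so `A B = B τ(A)` is multiplied by the adjugate of `B`
  -- instead of its inverse.
  have htr : B.det * A.trace = B.det * (A.map τ).trace := by
    have h := congrArg (fun C : Matrix ι ι R => (C * B.adjugate).trace) hAB
    simp only [Matrix.mul_assoc, Matrix.mul_adjugate] at h
    rw [Matrix.trace_mul_comm B, Matrix.mul_assoc, Matrix.adjugate_mul] at h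
    simpa only [Matrix.mul_smul, Matrix.mul_one, Matrix.trace_smul, smul_eq_mul] using h
  rw [LinearMap.trace_eq_matrix_trace R b, ← hA]
  exact (AddMonoidHom.map_trace τ A).trans (mul_left_cancel₀ hdet htr).symm

/-- The trace of an endomorphism commuting with a connection is killed by the derivation. -/
theorem LinearMap.map_trace_of_commute_connection (b : Module.Basis ι R M)
    (d : R →+ R) (D : M →+ M) (hD : ∀ r m, D (r • m) = r • D m + d r • m)
    (L : M →ₗ[R] M) (hL : ∀ m, L (D m) = D (L m)) : d (LinearMap.trace R M L) = 0 := by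
  classical
  have hsum : ∀ m, D m = ∑ k, b.repr m k • D (b k) + ∑ k, d (b.repr m k) • b k := fun m => by
    conv_lhs => rw [← b.sum_repr m]
    rw [_root_.map_sum, ← Finset.sum_add_distrib]
    exact Finset.sum_congr rfl fun k _ => hD _ _
  set A : Matrix ι ι R := LinearMap.toMatrix b b L with hA
  set B : Matrix ι ι R := Matrix.of fun i j => b.repr (D (b j)) i with hB
  have hAapp : ∀ i j, A i j = b.repr (L (b j)) i := fun i j => LinearMap.toMatrix_apply _ _ _ _ _
  have hAB : A * B = B * A + A.map d := by
    ext i j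
    have h1 : b.repr (L (D (b j))) i = ∑ k, A i k * B k j := by
      conv_lhs => rw [← b.sum_repr (D (b j))]
      simp only [_root_.map_sum, _root_.map_smul, Finsupp.coe_finsetSum, Finset.sum_apply,
        Finsupp.smul_apply, smul_eq_mul, hAapp, hB, Matrix.of_apply]
      exact Finset.sum_congr rfl fun k _ => mul_comm _ _
    have h2 : b.repr (D (L (b j))) i = ∑ k, B i k * A k j + d (A i j) := by
      rw [hsum, _root_.map_add, Finsupp.add_apply, b.repr_sum_self]
      simp only [_root_.map_sum, _root_.map_smul, Finsupp.coe_finsetSum, Finset.sum_apply,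
        Finsupp.smul_apply, smul_eq_mul, hAapp, hB, Matrix.of_apply]
      congr 1
      exact Finset.sum_congr rfl fun k _ => mul_comm _ _
    rw [Matrix.mul_apply, Matrix.add_apply, Matrix.mul_apply, ← h1, hL, h2]
    rfl
  have h := congrArg Matrix.trace hAB
  rw [Matrix.trace_add, Matrix.trace_mul_comm, left_eq_add] at h
  rw [LinearMap.trace_eq_matrix_trace R b, ← hA, ← h]
  exact AddMonoidHom.map_trace d A

/-- The trace is compatible with the reduction of a free module along a surjection. -/
theorem LinearMap.trace_eq_map_trace_of_surjective {k V : Type*} [CommRing k] [AddCommGroup V]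
    [Module k V] (b : Module.Basis ι R M) (σ : R →+* k) (hσ : Function.Surjective σ) (p : M →+ V)
    (hp : ∀ r m, p (r • m) = σ r • p m) (hps : Function.Surjective p)
    (hker : ∀ m, p m = 0 → ∃ (r : R) (x : M), σ r = 0 ∧ m = r • x)
    (L : M →ₗ[R] M) (g : V →ₗ[k] V) (hLg : ∀ m, p (L m) = g (p m)) :
    LinearMap.trace k V g = σ (LinearMap.trace R M L) := by
  have hsum : ∀ m, p m = ∑ i, σ (b.repr m i) • p (b i) := fun m => by
    conv_lhs => rw [← b.sum_repr m]
    rw [_root_.map_sum]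
    exact Finset.sum_congr rfl fun i _ => hp _ _
  -- A relation among the images lifts to an element of the kernel of `p`. Its coordinates are all
  -- multiples of some `r` with `σ r = 0`.
  have hli : LinearIndependent k fun i => p (b i) := by
    refine Fintype.linearIndependent_iff.mpr fun v hv i => ?_
    choose w hw using fun i => hσ (v i)
    obtain ⟨r, x, hr, hx⟩ := hker (∑ i, w i • b i) (by
      rw [_root_.map_sum, ← hv]
      exact Finset.sum_congr rfl fun i _ => by rw [hp, hw])
    have h := congrArg (fun m => b.repr m i) hx
    simp only [b.repr_sum_self, _root_.map_smul, Finsupp.smul_apply, smul_eq_mul] at h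
    rw [← hw, h, _root_.map_mul, hr, zero_mul]
  have hspan : ⊤ ≤ Submodule.span k (Set.range fun i => p (b i)) := by
    rintro v -
    obtain ⟨m, rfl⟩ := hps v
    rw [hsum]
    exact Submodule.sum_mem _ fun i _ => Submodule.smul_mem _ _ (Submodule.subset_span ⟨i, rfl⟩)
  let b' := Module.Basis.mk hli hspan
  have hb' : ∀ i, b' i = p (b i) := fun i => Module.Basis.mk_apply hli hspan i
  have hrepr : ∀ m i, b'.repr (p m) i = σ (b.repr m i) := fun m i => by
    rw [hsum m]
    simp only [← hb', b'.repr_sum_self]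
  rw [b.trace_eq_sum_repr, b'.trace_eq_sum_repr, _root_.map_sum]
  exact Finset.sum_congr rfl fun i _ => by rw [hb', ← hLg, hrepr]

/-- Precomposition with `g`, as a `K`-linear endomorphism of `End_F(K)`. -/
def LinearMap.precomp {F K : Type*} [Field F] [Field K] [Algebra F K] (g : Module.End F K) :
    Module.End F K →ₗ[K] Module.End F K where
  toFun h := h * g
  map_add' h h' := add_mul h h' g
  map_smul' a h := smul_mul_assoc a h g

/-- An `F`-basis `e` of `K` identifies `End_F(K)` with `K^n` by `h ↦ (h (e i))`. The diagonal
entries of precomposition with `g` are then those of the matrix of `g` in `e`. -/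
theorem LinearMap.trace_precomp {F K : Type*} [Field F] [Field K] [Algebra F K]
    [FiniteDimensional F K] (g : Module.End F K) :
    LinearMap.trace K (Module.End F K) (LinearMap.precomp g) =
      algebraMap F K (LinearMap.trace F K g) := by
  let e := Module.finBasis F K
  let b : Module.Basis (Fin (Module.finrank F K)) K (Module.End F K) :=
    Module.Basis.ofEquivFun (e.constr K).symm
  rw [b.trace_eq_sum_repr, e.trace_eq_sum_repr, _root_.map_sum]
  refine Finset.sum_congr rfl fun i _ => ?_
  have h1 : b i = e.constr K (Pi.single i 1) := by
    classical
    simp [b]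
  have h2 : b.repr (LinearMap.precomp g (b i)) i = b i (g (e i)) := by
    rw [Module.Basis.ofEquivFun_repr_apply]
    rfl
  rw [h2, h1, Module.Basis.constr_apply_fintype]
  simp [Pi.single_apply, Algebra.algebraMap_eq_smul_one, Module.Basis.equivFun_apply]

end Trace

/-! ### The Ore ring over `K[Z]` and its reduction by `ev c` -/

namespace OrePolynomial

variable {K : Type*} [Field K] {θ : K →+* K} {δ : SkewDerivation θ}

/-- `K` is simple over the image of `ev c`, which contains the multiplications by `K`, and its
commutant is `F` because `c` is unramified. Density, applied to a finite `F`-basis of `K`, then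
reaches every `F`-linear map. -/
theorem ev_surjective [FiniteDimensional δ.constants K] {c : K} (hc : ¬ δ.IsRamified c) :
    Function.Surjective (ev c : OrePolynomial δ →+* Module.End δ.constants K) := by
  intro g
  let S := (ev c : OrePolynomial δ →+* Module.End δ.constants K).range
  have hsimple : IsSimpleModule S K := by
    refine isSimpleModule_iff_toSpanSingleton_surjective.mpr ⟨inferInstance, fun x hx y => ?_⟩
    refine ⟨⟨ev c (C (y / x)), ⟨_, rfl⟩⟩, ?_⟩
    change ev c (C (y / x)) x = y
    rw [ev_C, div_mul_cancel₀ _ hx]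
  let G : Module.End (Module.End S K) K :=
    { toFun := g
      map_add' := _root_.map_add g
      map_smul' := fun φ x => by
        have hφ : ∀ f : OrePolynomial δ, ∀ x, φ (ev c f x) = ev c f (φ x) := fun f x =>
          _root_.map_smul φ (⟨ev c f, ⟨f, rfl⟩⟩ : S) x
        have hC : ∀ a x, φ (a * x) = a * φ x := fun a x => by
          have := hφ (C a) x
          rwa [ev_C, ev_C] at this
        have hX : ∀ x, φ (δ x + c * θ x) = δ (φ x) + c * θ (φ x) := fun x => by
          have := hφ X x
          rwa [ev_X, ev_X] at this
        have hx : ∀ x, φ x = φ 1 * x := fun x => by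
          rw [mul_comm, ← hC, mul_one]
        change g (φ x) = φ (g x)
        rw [hx, hx (g x)]
        exact _root_.map_smul g (⟨φ 1, mem_constants_of_commute hc hC hX⟩ : δ.constants) x }
  classical
  obtain ⟨r, hr⟩ := jacobson_density G
    (Finset.univ.image (Module.finBasis δ.constants K))
  obtain ⟨f, hf⟩ := r.2
  refine ⟨f, (Module.finBasis δ.constants K).ext fun i => ?_⟩
  rw [hf]
  exact (hr _ (Finset.mem_image_of_mem _ (Finset.mem_univ i))).symm

theorem C_mem_cPlus (Z : zPlus δ) (a : K) : C a ∈ cPlus Z :=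
  Subring.subset_closure (Or.inl ⟨a, rfl⟩)

theorem Z_mem_cPlus (Z : zPlus δ) : (Z : OrePolynomial δ) ∈ cPlus Z :=
  Subring.subset_closure (Or.inr rfl)

theorem cPlus_commute_C {Z : zPlus δ} {t : OrePolynomial δ} (ht : t ∈ cPlus Z) (a : K) :
    C a * t = t * C a :=
  congrArg Subtype.val (cPlus_mul_comm Z ⟨C a, C_mem_cPlus Z a⟩ ⟨t, ht⟩)

instance (Z : zPlus δ) : IsDomain (cPlus Z) where
  mul_left_cancel_of_ne_zero {a} ha b b' h := by
    have ha' : (a : OrePolynomial δ) ≠ 0 := fun h0 => ha (Subtype.ext h0)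
    exact Subtype.ext (mul_left_cancel₀ ha' (congrArg Subtype.val h))
  mul_right_cancel_of_ne_zero {a} ha b b' h := by
    have ha' : (a : OrePolynomial δ) ≠ 0 := fun h0 => ha (Subtype.ext h0)
    exact Subtype.ext (mul_right_cancel₀ ha' (congrArg Subtype.val h))

/-- `K[Z]` is a quotient of the ordinary polynomial ring over `K`, because `Z` commutes with `K`. -/
instance (Z : zPlus δ) : IsPrincipalIdealRing (cPlus Z) := by
  let φ : Polynomial K →+* cPlus Z := Polynomial.eval₂RingHom
    ((C : K →+* OrePolynomial δ).codRestrict (cPlus Z) (C_mem_cPlus Z)) ⟨Z, Z_mem_cPlus Z⟩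
  refine IsPrincipalIdealRing.of_surjective φ ?_
  rintro ⟨t, ht⟩
  have hle : cPlus Z ≤ (((cPlus Z).subtype : cPlus Z →+* OrePolynomial δ).comp φ).range := by
    refine Subring.closure_le.mpr ?_
    rintro x (⟨a, rfl⟩ | rfl)
    · exact ⟨Polynomial.C a, by simp [φ]⟩
    · exact ⟨Polynomial.X, by simp [φ]⟩
  obtain ⟨p, hp⟩ := hle ht
  exact ⟨p, Subtype.ext hp⟩

instance (Z : zPlus δ) : Module.IsTorsionFree (cPlus Z) (OrePolynomial δ) where
  isSMulRegular r hr x y h := by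
    have hr' : (r : OrePolynomial δ) ≠ 0 := fun h0 => hr.ne_zero (Subtype.ext h0)
    exact mul_left_cancel₀ hr' h

namespace IsCentralGenerator

variable {Z : zPlus δ} (hZ : IsCentralGenerator Z)
include hZ

theorem mem_cPlus {z : OrePolynomial δ} (hz : z ∈ zPlus δ) : z ∈ cPlus Z := by
  rw [← hZ.2] at hz
  induction hz using Algebra.adjoin_induction with
  | mem x hx => rw [Set.mem_singleton_iff.mp hx]; exact Z_mem_cPlus Z
  | algebraMap r => rw [algebraMap_eq]; exact C_mem_cPlus Z _
  | add x y _ _ hx hy => exact Subring.add_mem _ hx hy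
  | mul x y _ _ hx hy => exact Subring.mul_mem _ hx hy

/-- Since `N` is central, it lies in `K[Z]`, and repeated division by `N` shows that the powers `X ^
i` with `i < d` generate. -/
theorem finite [FiniteDimensional δ.constants K] {c : K} (hc : ¬ δ.IsRamified c) :
    Module.Finite (cPlus Z) (OrePolynomial δ) := by
  obtain ⟨N, d, hN⟩ := exists_isKernelGenerator (δ := δ) c
  have hz := hN.mem_zPlus hc
  let P := Submodule.span (cPlus Z) (Set.range fun i : Fin d => (X : OrePolynomial δ) ^ (i : ℕ))
  have hlow : ∀ m ≤ d, ∀ f ∈ degLT δ m, f ∈ P := fun m => by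
    induction m with
    | zero => intro _ f hf; rw [eq_zero_of_mem_degLT_zero hf]; exact Submodule.zero_mem _
    | succ m ih =>
      intro hm f hf
      rw [← sub_add_cancel f (monomial m (f.coeff m))]
      refine Submodule.add_mem _ (ih (by omega) _ (sub_monomial_mem_degLT hf)) ?_
      rw [monomial_eq]
      exact Submodule.smul_mem P (⟨C (f.coeff m), C_mem_cPlus Z _⟩ : cPlus Z)
        (Submodule.subset_span ⟨⟨m, hm⟩, rfl⟩)
  have hall : ∀ m, ∀ f ∈ degLT δ m, f ∈ P := fun m => by
    induction m with
    | zero => exact hlow 0 (Nat.zero_le d)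
    | succ m ih =>
      intro f hf
      obtain ⟨q, hq, s, hs, rfl⟩ := exists_eq_mul_add hN.mem_deg hN.leading (m + 1) f hf
      refine Submodule.add_mem _ ?_ (hlow d le_rfl s hs)
      rw [Subalgebra.mem_center_iff.mp hz]
      exact Submodule.smul_mem P (⟨N, hZ.mem_cPlus hz⟩ : cPlus Z)
        (ih q (degLT_mono (by have := hN.pos; omega) hq))
  refine ⟨Submodule.fg_def.mpr ⟨_, Set.finite_range _, show P = ⊤ from ?_⟩⟩
  refine eq_top_iff.mpr fun f _ => ?_
  obtain ⟨m, hm⟩ := exists_mem_degLT f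
  exact hall m f hm

end IsCentralGenerator

theorem ev_cPlus {c : K} (hc : ¬ δ.IsRamified c) {Z : zPlus δ} {t : OrePolynomial δ}
    (ht : t ∈ cPlus Z) (x : K) : ev c t x = ev c t 1 * x := by
  induction ht using Subring.closure_induction generalizing x with
  | mem t ht =>
    rcases ht with ⟨a, rfl⟩ | rfl
    · rw [ev_C, ev_C, mul_one]
    · exact (ev_central hc Z.2).2 x
  | zero => simp
  | one => simp
  | add s t _ _ hs ht => rw [_root_.map_add, LinearMap.add_apply, hs, ht, LinearMap.add_apply, add_mul]
  | neg t _ ht => rw [_root_.map_neg, LinearMap.neg_apply, ht, LinearMap.neg_apply, neg_mul]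
  | mul s t _ _ hs ht =>
    rw [_root_.map_mul, Module.End.mul_apply, hs, ht, Module.End.mul_apply, hs (ev c t 1), mul_assoc]

/-- The character of `K[Z]` through which it acts on `K` by `ev c`. -/
noncomputable def evChar {c : K} (hc : ¬ δ.IsRamified c) (Z : zPlus δ) : cPlus Z →+* K where
  toFun t := ev c (t : OrePolynomial δ) 1
  map_one' := by simp
  map_zero' := by simp
  map_add' s t := by simp
  map_mul' s t := by
    rw [Subring.coe_mul, _root_.map_mul, Module.End.mul_apply, ev_cPlus hc s.2]

/-- The character of the centre through which it acts on `K` by `ev c`. -/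
noncomputable def specialize {c : K} (hc : ¬ δ.IsRamified c) : zPlus δ →ₐ[δ.constants] δ.constants where
  toFun z := ⟨ev c (z : OrePolynomial δ) 1, (ev_central hc z.2).1⟩
  map_one' := Subtype.ext (by simp)
  map_zero' := Subtype.ext (by simp)
  map_add' s t := Subtype.ext (by simp)
  map_mul' s t := Subtype.ext (by
    change ev c ((s : OrePolynomial δ) * (t : OrePolynomial δ)) 1 =
      ev c (s : OrePolynomial δ) 1 * ev c (t : OrePolynomial δ) 1
    rw [_root_.map_mul, Module.End.mul_apply, (ev_central hc s.2).2])
  commutes' a := Subtype.ext (by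
    change ev c (algebraMap δ.constants (OrePolynomial δ) a) 1 = (a : K)
    rw [algebraMap_eq, ev_C, mul_one])

theorem upsilon_eq (Z : zPlus δ) (c : K) : upsilon Z c = ev c (Z : OrePolynomial δ) 1 := by
  obtain ⟨Q, hQ⟩ := (existsUnique_rem (Z : OrePolynomial δ) c).choose_spec.1
  rw [hQ]
  simp [ev_C, ev_X, δ.map_one, upsilon]

namespace IsCentralGenerator

variable {Z : zPlus δ} (hZ : IsCentralGenerator Z)
include hZ

/-- This is Taylor expansion to first order: a polynomial in `Z` is congruent to its value at `υ(c)`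
modulo `Z - υ(c)`. -/
theorem exists_eq_C_add {c : K} (hc : ¬ δ.IsRamified c) {z : OrePolynomial δ} (hz : z ∈ zPlus δ) :
    ∃ g, z = C (ev c z 1) + ((Z : OrePolynomial δ) - C (ev c (Z : OrePolynomial δ) 1)) * g := by
  have hw : ∀ a, C a * ((Z : OrePolynomial δ) - C (ev c (Z : OrePolynomial δ) 1)) =
      ((Z : OrePolynomial δ) - C (ev c (Z : OrePolynomial δ) 1)) * C a :=
    cPlus_commute_C (Subring.sub_mem _ (Z_mem_cPlus Z) (C_mem_cPlus Z _))
  have key : ∀ z ∈ Algebra.adjoin δ.constants {(Z : OrePolynomial δ)},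
      ∃ g, z = C (ev c z 1) + ((Z : OrePolynomial δ) - C (ev c (Z : OrePolynomial δ) 1)) * g := by
    intro z hz
    induction hz using Algebra.adjoin_induction with
    | mem x hx => exact ⟨1, by rw [Set.mem_singleton_iff.mp hx, mul_one, add_sub_cancel]⟩
    | algebraMap r => exact ⟨0, by rw [algebraMap_eq, ev_C, mul_one, mul_zero, add_zero]⟩
    | add x y _ _ hx hy =>
      obtain ⟨g, hg⟩ := hx
      obtain ⟨h, hh⟩ := hy
      refine ⟨g + h, ?_⟩
      nth_rewrite 1 [hg, hh]
      rw [_root_.map_add, LinearMap.add_apply, _root_.map_add, mul_add]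
      abel
    | mul x y hx' hy' hx hy =>
      obtain ⟨g, hg⟩ := hx
      obtain ⟨h, hh⟩ := hy
      rw [hZ.2] at hx'
      refine ⟨C (ev c x 1) * h + g * y, ?_⟩
      rw [_root_.map_mul, Module.End.mul_apply, (ev_central hc hx').2 (ev c y 1), _root_.map_mul,
        mul_add, ← mul_assoc, ← hw, ← add_assoc, mul_assoc (C _), ← mul_add, ← hh, ← mul_assoc,
        ← add_mul, ← hg]
  exact key z (by rw [hZ.2]; exact hz)

/-- The central element `N` takes the value zero, hence is a multiple of `Z - υ(c)`, and every
kernel element is a multiple of `N`. -/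
theorem eq_mul_of_ev_eq_zero [FiniteDimensional δ.constants K] {c : K} (hc : ¬ δ.IsRamified c)
    {f : OrePolynomial δ} (hf : ev c f = 0) :
    ∃ x, f = ((Z : OrePolynomial δ) - C (ev c (Z : OrePolynomial δ) 1)) * x := by
  obtain ⟨N, d, hN⟩ := exists_isKernelGenerator (δ := δ) c
  have hz := hN.mem_zPlus hc
  obtain ⟨q, rfl⟩ := hN.eq_mul_of_ev_eq_zero hf
  obtain ⟨g, hg⟩ := hZ.exists_eq_C_add hc hz
  rw [hN.ev_eq_zero, LinearMap.zero_apply, _root_.map_zero, zero_add] at hg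
  refine ⟨g * q, ?_⟩
  rw [Subalgebra.mem_center_iff.mp hz, ← mul_assoc, ← hg]

theorem evChar_trace [FiniteDimensional δ.constants K] {c : K} (hc : ¬ δ.IsRamified c)
    (f : OrePolynomial δ) :
    ev c (reducedTrace Z f) 1 = (LinearMap.trace δ.constants K (ev c f) : K) := by
  have := hZ.finite hc
  let b := Module.Free.chooseBasis (cPlus Z) (OrePolynomial δ)
  have h := LinearMap.trace_eq_map_trace_of_surjective (k := K) b (evChar hc Z)
    (fun a => ⟨⟨C a, C_mem_cPlus Z a⟩, by
      change ev c (C a) 1 = a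
      rw [ev_C, mul_one]⟩)
    (ev c : OrePolynomial δ →+* Module.End δ.constants K).toAddMonoidHom
    (fun r m => by
      ext x
      change ev c ((r : OrePolynomial δ) * m) x = ev c (r : OrePolynomial δ) 1 * ev c m x
      rw [_root_.map_mul, Module.End.mul_apply, ev_cPlus hc r.2])
    (ev_surjective hc)
    (fun m hm => by
      obtain ⟨x, hx⟩ := hZ.eq_mul_of_ev_eq_zero hc hm
      refine ⟨⟨_, Subring.sub_mem _ (Z_mem_cPlus Z) (C_mem_cPlus Z _)⟩, x, ?_, hx⟩
      change ev c _ 1 = 0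
      rw [_root_.map_sub, LinearMap.sub_apply, ev_C, mul_one, sub_self])
    (rightMul Z f) (LinearMap.precomp (ev c f)) (fun m => _root_.map_mul (ev c) m f)
  rw [LinearMap.trace_precomp] at h
  exact h.symm

end IsCentralGenerator

/-! ### Centrality of the reduced trace -/

theorem reducedTrace_mem_cPlus (Z : zPlus δ) (f : OrePolynomial δ) : reducedTrace Z f ∈ cPlus Z :=
  Subtype.prop _

/-- For `θ = id`, commutation with `X` is a derivation of `K[Z]`. -/
theorem X_commute_reducedTrace_of_eq_id (hθ : θ = RingHom.id K) (Z : zPlus δ)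
    [Module.Free (cPlus Z) (OrePolynomial δ)] [Module.Finite (cPlus Z) (OrePolynomial δ)]
    (f : OrePolynomial δ) : X * reducedTrace Z f = reducedTrace Z f * X := by
  have hmem : ∀ t ∈ cPlus Z, X * t - t * X ∈ cPlus Z := fun t ht => by
    induction ht using Subring.closure_induction with
    | mem t ht =>
      rcases ht with ⟨a, rfl⟩ | rfl
      · rw [X_mul_C, RingHom.congr_fun hθ a, RingHom.id_apply, add_sub_cancel_left]
        exact C_mem_cPlus Z _
      · rw [Subalgebra.mem_center_iff.mp Z.2 X, sub_self]
        exact Subring.zero_mem _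
    | zero => simp
    | one => simp
    | add s t _ _ hs ht =>
      have := Subring.add_mem _ hs ht
      rwa [sub_add_sub_comm, ← mul_add, ← add_mul] at this
    | neg t _ ht =>
      have := Subring.neg_mem _ ht
      rwa [neg_sub', ← mul_neg, ← neg_mul] at this
    | mul s t hs' ht' hs ht =>
      have h : X * (s * t) - s * t * X = (X * s - s * X) * t + s * (X * t - t * X) := by
        noncomm_ring
      rw [h]
      exact Subring.add_mem _ (Subring.mul_mem _ hs ht') (Subring.mul_mem _ hs' ht)
  let D : cPlus Z →+ cPlus Z :=
    { toFun := fun t => ⟨X * (t : OrePolynomial δ) - (t : OrePolynomial δ) * X, hmem t t.2⟩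
      map_zero' := Subtype.ext (by simp)
      map_add' := fun s t => Subtype.ext (by
        simp only [Subring.coe_add, mul_add, add_mul]
        abel) }
  let b := Module.Free.chooseBasis (cPlus Z) (OrePolynomial δ)
  have h := LinearMap.map_trace_of_commute_connection b D (AddMonoidHom.mulLeft X)
    (fun r m => by
      change X * ((r : OrePolynomial δ) * m) = (r : OrePolynomial δ) * (X * m) +
        (X * (r : OrePolynomial δ) - (r : OrePolynomial δ) * X) * m
      noncomm_ring)
    (rightMul Z f) (fun m => mul_assoc X m f)
  exact sub_eq_zero.mp (congrArg Subtype.val h)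

/-- For `W` the set of pairs `(t, s)` with `Y t = s Y`, this extends conjugation by `Y` from the
generators to `K[Z]`: the elements having a partner form a subring. -/
theorem exists_mem_subring_prod {Z : zPlus δ} (W : Subring (OrePolynomial δ × OrePolynomial δ))
    (hC : ∀ a, ∃ s ∈ cPlus Z, (C a, s) ∈ W)
    (hZ : ((Z : OrePolynomial δ), (Z : OrePolynomial δ)) ∈ W) {t : OrePolynomial δ}
    (ht : t ∈ cPlus Z) : ∃ s ∈ cPlus Z, (t, s) ∈ W := by
  have hle : cPlus Z ≤
      (W ⊓ (cPlus Z).comap (RingHom.snd _ _)).map (RingHom.fst _ (OrePolynomial δ)) := by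
    refine Subring.closure_le.mpr ?_
    rintro x (⟨a, rfl⟩ | rfl)
    · obtain ⟨s, hs, h⟩ := hC a
      exact ⟨_, ⟨h, hs⟩, rfl⟩
    · exact ⟨_, ⟨hZ, Z_mem_cPlus Z⟩, rfl⟩
  obtain ⟨⟨_, s⟩, ⟨h, hs⟩, rfl⟩ := hle ht
  exact ⟨s, hs, h⟩

/-- If `X + γ` is semilinear, conjugation by it is an automorphism of `K[Z]`. -/
theorem X_commute_reducedTrace_of_inner [FiniteDimensional δ.constants K] {γ : K}
    (hγ : ∀ a, δ a = γ * (θ a - a)) (Z : zPlus δ)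
    [Module.Free (cPlus Z) (OrePolynomial δ)] [Module.Finite (cPlus Z) (OrePolynomial δ)]
    (f : OrePolynomial δ) : X * reducedTrace Z f = reducedTrace Z f * X := by
  obtain ⟨Y, hYdef⟩ : ∃ Y : OrePolynomial δ, Y = X + C γ := ⟨_, rfl⟩
  have hY0 : Y ≠ 0 := fun h => by
    have := congrArg (fun f => coeff f 1) h
    simp [hYdef, coeff_add, X, C, coeff_monomial, coeff_zero] at this
  have hYC : ∀ a, Y * C a = C (θ a) * Y := fun a => by
    rw [hYdef, add_mul, X_mul_C, mul_add, add_assoc, hγ, ← _root_.map_mul, ← _root_.map_mul,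
      ← _root_.map_add]
    congr 2
    ring
  have hYZ : Y * Z = Z * Y := Subalgebra.mem_center_iff.mp Z.2 Y
  let W : Subring (OrePolynomial δ × OrePolynomial δ) :=
    { carrier := {p | Y * p.1 = p.2 * Y}
      zero_mem' := (mul_zero Y).trans (zero_mul Y).symm
      one_mem' := (mul_one Y).trans (one_mul Y).symm
      add_mem' := fun {p q} (hp : _ = _) (hq : _ = _) =>
        (mul_add Y _ _).trans ((congrArg₂ _ hp hq).trans (add_mul _ _ Y).symm)
      neg_mem' := fun {p} (hp : _ = _) =>
        (mul_neg Y _).trans ((congrArg _ hp).trans (neg_mul _ Y).symm)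
      mul_mem' := fun {p q} (hp : _ = _) (hq : _ = _) => by
        change Y * (p.1 * q.1) = p.2 * q.2 * Y
        rw [← mul_assoc, hp, mul_assoc, hq, mul_assoc] }
  have hex : ∀ t ∈ cPlus Z, ∃ s ∈ cPlus Z, Y * t = s * Y := fun t ht =>
    exists_mem_subring_prod W (fun a => ⟨_, C_mem_cPlus Z _, hYC a⟩) hYZ ht
  -- Exchanging the coordinates of `W` gives surjectivity of the conjugation; on constants it is
  -- that of `θ`.
  have hsurj : ∀ s ∈ cPlus Z, ∃ t ∈ cPlus Z, Y * t = s * Y := fun s hs =>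
    exists_mem_subring_prod (W.comap (RingEquiv.prodComm : OrePolynomial δ × OrePolynomial δ ≃+* _).toRingHom)
      (fun a => by
        obtain ⟨b, rfl⟩ := δ.surjective_theta a
        exact ⟨_, C_mem_cPlus Z _, hYC b⟩) hYZ hs
  choose τ' hτ'm hτ' using hex
  have huniq : ∀ (t : OrePolynomial δ) (ht : t ∈ cPlus Z) (s : OrePolynomial δ),
      Y * t = s * Y → τ' t ht = s := fun t ht s h =>
    mul_right_cancel₀ hY0 ((hτ' t ht).symm.trans h)
  let τ : cPlus Z →+ cPlus Z :=
    { toFun := fun t => ⟨τ' t t.2, hτ'm t t.2⟩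
      map_zero' := Subtype.ext (huniq _ _ _ (by simp))
      map_add' := fun s t => Subtype.ext (huniq _ _ _ (by
        rw [Subring.coe_add, mul_add, hτ' s s.2, hτ' t t.2]
        exact (add_mul _ _ Y).symm)) }
  let b := Module.Free.chooseBasis (cPlus Z) (OrePolynomial δ)
  have h := LinearMap.map_trace_of_commute_semilinear b τ
    (fun s => by
      obtain ⟨t, ht, h⟩ := hsurj s s.2
      exact ⟨⟨t, ht⟩, Subtype.ext (huniq _ _ _ h)⟩)
    (AddMonoidHom.mulLeft Y)
    (fun r m => by
      change Y * ((r : OrePolynomial δ) * m) = τ' r r.2 * (Y * m)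
      rw [← mul_assoc, hτ', mul_assoc])
    (fun x y h => mul_left_cancel₀ hY0 h)
    (rightMul Z f) (fun m => mul_assoc Y m f)
  have h1 := hτ' _ (reducedTrace_mem_cPlus Z f)
  have h2 : τ' _ (reducedTrace_mem_cPlus Z f) = reducedTrace Z f := congrArg Subtype.val h
  rw [h2, hYdef, add_mul, mul_add, cPlus_commute_C (reducedTrace_mem_cPlus Z f)] at h1
  exact add_right_cancel h1

theorem reducedTrace_mem_zPlus [FiniteDimensional δ.constants K] (Z : zPlus δ)
    [Module.Free (cPlus Z) (OrePolynomial δ)] [Module.Finite (cPlus Z) (OrePolynomial δ)]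
    (f : OrePolynomial δ) : reducedTrace Z f ∈ zPlus δ := by
  refine mem_zPlus_of_commute (cPlus_commute_C (reducedTrace_mem_cPlus Z f)) ?_
  by_cases hθ : θ = RingHom.id K
  · exact X_commute_reducedTrace_of_eq_id hθ Z f
  · obtain ⟨γ, hγ⟩ := δ.exists_inner hθ
    exact X_commute_reducedTrace_of_inner hγ Z f

end OrePolynomial

theorem mainTheorem6 {K : Type*} [Field K] (θ : K →+* K) (δ : SkewDerivation θ)
    [FiniteDimensional δ.constants K] (c : K) (hc : ¬ δ.IsRamified c) :
    (∃ Z : OrePolynomial.zPlus δ, OrePolynomial.IsCentralGenerator Z) ∧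
    ∀ Z : OrePolynomial.zPlus δ, OrePolynomial.IsCentralGenerator Z →
      Module.Free (OrePolynomial.cPlus Z) (OrePolynomial δ) ∧
      Module.Finite (OrePolynomial.cPlus Z) (OrePolynomial δ) ∧
      ∃ hT : ∀ f : OrePolynomial δ,
          OrePolynomial.reducedTrace Z f ∈ OrePolynomial.zPlus δ,
        ∃ spec : OrePolynomial.zPlus δ →ₐ[δ.constants] δ.constants,
          (spec Z : K) = OrePolynomial.upsilon Z c ∧
          ∀ f : OrePolynomial δ,
            spec ⟨OrePolynomial.reducedTrace Z f, hT f⟩ =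
              LinearMap.trace δ.constants K (OrePolynomial.ev c f) := by
  refine ⟨?_, fun Z hZ => ?_⟩
  · obtain ⟨N, d, hN⟩ := OrePolynomial.exists_isKernelGenerator (δ := δ) c
    exact ⟨_, hN.isCentralGenerator hc (hN.mem_zPlus hc)⟩
  · have hfin := hZ.finite hc
    -- A finite torsion-free module over a principal ideal domain is free.
    have hfree : Module.Free (OrePolynomial.cPlus Z) (OrePolynomial δ) := inferInstance
    exact ⟨hfree, hfin, OrePolynomial.reducedTrace_mem_zPlus Z, OrePolynomial.specialize hc,
      (OrePolynomial.upsilon_eq Z c).symm, fun f => Subtype.ext (hZ.evChar_trace hc f)⟩
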